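/- Conventions. A continuity modulus is a function $\gamma$ with $\gamma(\varepsilon)>0$ for all $\varepsilon>0$. A map obeys $\gamma$ if changing one of its arguments by less than $\gamma(\varepsilon)$ changes its value by less than $\varepsilon$, for every $\varepsilon>0$. A metric group is a topological group with a compatible metric. A real tree is a geodesic $0$-hyperbolic metric space. A compact presentation of a metric group $G$ is an increasing sequence $K_0\subseteq K_1\subseteq\cdots$ of non-empty compact sets with $G=\bigcup_n K_n$ and $\{1\}\cup K_nK_n\cup K_n^{-1}\subseteq K_{n+1}$ for all $n$. Let $\nu:\omega\times\omega\to\omega$ and $\eta:\omega\to\omega\times(\omega\setminus\{0\})$, let $\mathcal F=(F_{n,m})$ be a family of continuity moduli, and let $\mathcal F_0$ consist of a continuity modulus for multiplication and one for inversion for each $n$. The class $\mathcal K_{GR}(\nu,\mathcal F)$ consists of the many-sorted continuous metric structures with complete sorts $(K_n)_{n\in\omega}$, $(B_n)_{n\in\omega}$ that come from an isometric action of a metric group $G$ on a real tree $T$ with base point $0$. Here $G=\bigcup_nK_n$ is an increasing union of non-empty closed sets of bounded diameters with $\{1\}\cup K_nK_n\cup K_n^{-1}\subseteq K_{n+1}$;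 $B_n$ is the closed $n$-ball of $0$ in $T$; and the operations are $1$, the multiplications $K_n\times K_n\to K_{n+1}$ and inversions $K_n\to K_{n+1}$ (obeying $\mathcal F_0$), the point $0$, the inclusions $B_m\to B_n$ ($m\le n$), and the action maps $K_n\times B_m\to B_{\nu(n,m)}$ (obeying $F_{n,m}$). The class $\mathcal K_{nFR}(\nu,\eta,\mathcal F)$ consists of those structures in $\mathcal K_{GR}(\nu,\mathcal F)$ that satisfy $$\sup_{v\in B_k}\ \inf_{x\in K_l}\ \max\Big(\frac1s-d(x\circ v,v),\,0\Big)=0\qquad\text{for every } k,\ \text{where } \eta(k)=(l,s).$$ Proposition. Let $G$ be a $\sigma$-compact locally compact metric group. Then $G$ has a compact presentation consisting of neighbourhoods of $1$. Let $(K_n)$ be any compact presentation of $G$. There is a family $\mathcal F_0$ of continuity moduli obeyed by the multiplications $K_n\times K_n\to K_{n+1}$ and the inversions $K_n\to K_{n+1}$. Fix any such $\mathcal F_0$ and any family $\mathcal F=(F_{n,m})$ of continuity moduli. Suppose that $G$ acts isometrically and without a global fixed point on a complete real tree $T$ with base point $0$, that the action is strongly continuous ($g\mapsto g x$ is continuous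 for every $x\in T$), and that for all $n,m$ the action map on $K_n\times B_m$ obeys $F_{n,m}$. Then there are a function $\nu:\omega\times\omega\to\omega$, strictly increasing in each argument, and a function $\eta:\omega\to\omega\times(\omega\setminus\{0\})$ such that $K_n\circ B_m\subseteq B_{\nu(n,m)}$ for all $n,m$ and the many-sorted structure of this action belongs to $\mathcal K_{nFR}(\nu,\eta,\mathcal F)$. Moreover, if $\eta(k)=(l,s)$, then every $v\in B_k$ satisfies $d(gv,v)\ge \frac1s$ for some $g\in K_l$. -/

import Mathlib

open Set Topology Pointwise

universe u v

/-- A continuity modulus: a function that is positive at positive arguments. -/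
structure ContinuityModulus where
  toFun : ℝ → ℝ
  pos : ∀ ε, 0 < ε → 0 < toFun ε

/-- The unary map `f` obeys the continuity modulus `γ`. -/
def ObeysModulus {X Y : Type*} [MetricSpace X] [MetricSpace Y]
    (γ : ContinuityModulus) (f : X → Y) : Prop :=
  ∀ ε, 0 < ε → ∀ x x', dist x x' < γ.toFun ε → dist (f x) (f x') < ε

/-- The binary map `f` obeys the continuity modulus `γ` in each of its arguments. -/
def ObeysModulus₂ {X Y Z : Type*} [MetricSpace X] [MetricSpace Y] [MetricSpace Z]
    (γ : ContinuityModulus) (f : X → Y → Z) : Prop :=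
  (∀ y, ObeysModulus γ fun x => f x y) ∧ ∀ x, ObeysModulus γ (f x)

/-- Continuity moduli for multiplication `K n × K n → K (n + 1)` and inversion
`K n → K (n + 1)`. -/
structure GroupModuli where
  mul : ℕ → ContinuityModulus
  inv : ℕ → ContinuityModulus

/-- A real tree: a metric space in which any two points are joined by a geodesic and which
is `0`-hyperbolic (the four point condition). -/
structure IsRealTree (T : Type*) [MetricSpace T] : Prop where
  geodesic : ∀ x y : T, ∃ c : ℝ → T, c 0 = x ∧ c (dist x y) = y ∧
    ∀ s ∈ Icc 0 (dist x y), ∀ t ∈ Icc 0 (dist x y), dist (c s) (c t) = |s - t|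
  fourPoint : ∀ x y z w : T,
    dist x y + dist z w ≤ max (dist x z + dist y w) (dist x w + dist y z)

/-- `G` is presented as the union of the increasing sequence of nonempty closed sets `K n` of
bounded diameters with `{1} ∪ K n * K n ∪ (K n)⁻¹ ⊆ K (n + 1)`. -/
structure IsPresentation {G : Type*} [Group G] [MetricSpace G] (K : ℕ → Set G) : Prop where
  nonempty : ∀ n, (K n).Nonempty
  closed : ∀ n, IsClosed (K n)
  bounded : ∀ n, Bornology.IsBounded (K n)
  mono : Monotone K
  one_mem : ∀ n, (1 : G) ∈ K (n + 1)
  mul_subset : ∀ n, K n * K n ⊆ K (n + 1)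
  inv_subset : ∀ n, (K n)⁻¹ ⊆ K (n + 1)
  iUnion_eq : ⋃ n, K n = univ

/-- The multiplication and inversion maps of the sorts `K n` obey the moduli `F₀`. -/
def GroupObeysModuli {G : Type*} [Group G] [MetricSpace G] (K : ℕ → Set G)
    (F₀ : GroupModuli) : Prop :=
  ∀ n, ObeysModulus₂ (F₀.mul n) (fun g h : K n => (g : G) * (h : G)) ∧
    ObeysModulus (F₀.inv n) (fun g : K n => (g : G)⁻¹)

/-- A strongly `F`-continuous action on a space with base point `o`: orbit maps are
continuous, and the action map on `K n × B m` obeys `F n m`, where `B m` is the closed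
`m`-ball of `o`. -/
def StronglyModuliContinuous {G : Type*} {T : Type*} [Group G] [MetricSpace G] [MetricSpace T]
    [MulAction G T] (K : ℕ → Set G) (o : T) (F : ℕ → ℕ → ContinuityModulus) : Prop :=
  (∀ x : T, Continuous fun g : G => g • x) ∧
    ∀ n m : ℕ, ObeysModulus₂ (F n m)
      (fun (g : K n) (x : Metric.closedBall o (m : ℝ)) => (g : G) • (x : T))

/-- Many-sorted structures with group sorts `K n` carrying `·`, `⁻¹`, `1`, with sorts `B n`
carrying a base point and maps `I`, and with an operation `∘ : K n × B m → B (ν n m)`. -/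
structure GroupTreeStructure (ν : ℕ → ℕ → ℕ) where
  K : ℕ → Type u
  B : ℕ → Type v
  metricK : ∀ n, MetricSpace (K n)
  metricB : ∀ n, MetricSpace (B n)
  mul : ∀ n, K n → K n → K (n + 1)
  inv : ∀ n, K n → K (n + 1)
  one : ∀ n, K (n + 1)
  zero : ∀ n, B n
  I : ∀ {m n : ℕ}, m ≤ n → B m → B n
  act : ∀ n m, K n → B m → B (ν n m)

attribute [instance] GroupTreeStructure.metricK GroupTreeStructure.metricB

/-- `M` is (via the isometric embeddings `i`, `j` of its sorts) the structure given by the group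
`G` presented as the union of the images of the sorts `K n`, by the space `T` with base point
`o`, whose closed `n`-ball is the image of the sort `B n`, and by the action of `G` on `T`. -/
structure GroupTreeStructure.IsRealizedBy {ν : ℕ → ℕ → ℕ} (M : GroupTreeStructure.{u, v} ν)
    (G : Type u) [Group G] [MetricSpace G] (T : Type v) [MetricSpace T] [MulAction G T]
    (o : T) (i : ∀ n, M.K n → G) (j : ∀ n, M.B n → T) : Prop where
  isometry_i : ∀ n, Isometry (i n)
  isometry_j : ∀ n, Isometry (j n)
  presentation : IsPresentation fun n => range (i n)
  range_j : ∀ n, range (j n) = Metric.closedBall o (n : ℝ)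
  map_mul : ∀ n x y, i (n + 1) (M.mul n x y) = i n x * i n y
  map_inv : ∀ n x, i (n + 1) (M.inv n x) = (i n x)⁻¹
  map_one : ∀ n, i (n + 1) (M.one n) = 1
  map_zero : ∀ n, j n (M.zero n) = o
  map_I : ∀ (m n : ℕ) (h : m ≤ n) v, j n (M.I h v) = j m v
  map_act : ∀ n m x v, j (ν n m) (M.act n m x v) = i n x • j m v

/-- The class `K_GR(ν, F)`, with group moduli `F₀`: metric structures (complete sorts, operations
obeying their moduli) that come from an isometric action of a metric group on a pointed
real tree. -/
def ClassKGR (ν : ℕ → ℕ → ℕ) (F₀ : GroupModuli) (F : ℕ → ℕ → ContinuityModulus) :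
    Set (GroupTreeStructure.{u, v} ν) :=
  {M | (∀ n, CompleteSpace (M.K n)) ∧ (∀ n, CompleteSpace (M.B n)) ∧
    (∀ n, ObeysModulus₂ (F₀.mul n) (M.mul n)) ∧
    (∀ n, ObeysModulus (F₀.inv n) (M.inv n)) ∧
    (∀ n m, ObeysModulus₂ (F n m) (M.act n m)) ∧
    ∃ (G : Type u) (_ : Group G) (_ : MetricSpace G) (_ : IsTopologicalGroup G)
      (T : Type v) (_ : MetricSpace T) (_ : MulAction G T) (_ : IsIsometricSMul G T)
      (o : T) (i : ∀ n, M.K n → G) (j : ∀ n, M.B n → T),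
      IsRealTree T ∧ M.IsRealizedBy G T o i j}

/-- The class `K_nFR(ν, η, F)`: the members of `K_GR(ν, F)` that satisfy, for each `k` with
`η k = (l, s)`, the axiom `sup_{v ∈ B k} inf_{x ∈ K l} (1 / s ∸ d (x ∘ v, v)) = 0`.
The distance is taken in a sort that contains both `x ∘ v` and `v`. -/
noncomputable def ClassKnFR (ν : ℕ → ℕ → ℕ) (η : ℕ → ℕ × ℕ) (F₀ : GroupModuli)
    (F : ℕ → ℕ → ContinuityModulus) : Set (GroupTreeStructure.{u, v} ν) :=
  {M | M ∈ ClassKGR ν F₀ F ∧ ∀ k, 0 < (η k).2 ∧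
    (⨆ v : M.B k, ⨅ x : M.K (η k).1,
      max ((1 : ℝ) / ((η k).2 : ℝ) -
        dist (M.I (le_max_left (ν (η k).1 k) k) (M.act (η k).1 k x v))
          (M.I (le_max_right (ν (η k).1 k) k) v)) 0) = 0}

/-- The many-sorted structure of an action of `G` on `T`: the sorts are the sets `K n` and the
closed balls of `o`, and all operations are restrictions of those of `G`, `T` and the action. -/
def actionStructure {G : Type u} [Group G] [MetricSpace G] {T : Type v} [MetricSpace T]
    [MulAction G T] (K : ℕ → Set G) (hK : IsPresentation K) (o : T) (ν : ℕ → ℕ → ℕ)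
    (hν : ∀ n m : ℕ, ∀ g ∈ K n, ∀ x ∈ Metric.closedBall o (m : ℝ),
      g • x ∈ Metric.closedBall o (ν n m : ℝ)) :
    GroupTreeStructure.{u, v} ν where
  K n := K n
  B n := Metric.closedBall o (n : ℝ)
  metricK _ := inferInstance
  metricB _ := inferInstance
  mul n g h := ⟨(g : G) * (h : G), hK.mul_subset n (mul_mem_mul g.2 h.2)⟩
  inv n g := ⟨(g : G)⁻¹, hK.inv_subset n (inv_mem_inv.2 g.2)⟩
  one n := ⟨1, hK.one_mem n⟩
  zero n := ⟨o, Metric.mem_closedBall_self n.cast_nonneg⟩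
  I h v := ⟨v, Metric.closedBall_subset_closedBall (Nat.cast_le.2 h) v.2⟩
  act n m g v := ⟨(g : G) • (v : T), hν n m g g.2 v v.2⟩

/-!
The displacement condition comes from a fixed point theorem. In a real tree the four point
condition says that the midpoint `m` of `x` and `y` satisfies
`d(z, m) ≤ max (d(z, x)) (d(z, y)) - d(x, y) / 2` for every `z`. Consequently, in a complete real
tree, the radius of a bounded set, as a function of the centre, has a minimizer, and only one. The
minimizer for a bounded orbit is a fixed point (`exists_fixedPoint_of_bounded_orbit`).

If for some `k` every `K l` had a point of the `k`-ball of `o` that it moves by less than `1`, then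
every element of the group would move `o` by at most `2 * k + 1`, so that the action would have a
fixed point. Hence for each `k` some `K l` moves every point of the `k`-ball by at least `1`
(`exists_one_le_dist_smul`), and `η k = (l, 1)` will do. The function `ν` exists because compact sets
of group elements move `o` a bounded distance, and the moduli `F₀` exist because continuous maps on
compact spaces are uniformly continuous.
-/

open Filter

/-- The sequence `K 0 = U`, `K (n + 1) = {1} ∪ K n ∪ K n * K n ∪ (K n)⁻¹ ∪ C n`. -/
def presentationOf {G : Type*} [Group G] (U : Set G) (C : ℕ → Set G) : ℕ → Set G
  | 0 => U
  | n + 1 => {1} ∪ presentationOf U C n ∪ presentationOf U C n * presentationOf U C n ∪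
      (presentationOf U C n)⁻¹ ∪ C n

theorem exists_isPresentation_isCompact_mem_nhds_one {G : Type*} [Group G] [MetricSpace G]
    [IsTopologicalGroup G] [LocallyCompactSpace G] [SigmaCompactSpace G] :
    ∃ K : ℕ → Set G, IsPresentation K ∧ ∀ n, IsCompact (K n) ∧ K n ∈ 𝓝 (1 : G) := by
  obtain ⟨U, hUc, hU⟩ := exists_compact_mem_nhds (1 : G)
  let K : ℕ → Set G := presentationOf U (compactCovering G)
  have hsucc : ∀ n, K (n + 1) = {1} ∪ K n ∪ K n * K n ∪ (K n)⁻¹ ∪ compactCovering G n :=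
    fun _ => rfl
  have hcpt : ∀ n, IsCompact (K n) := by
    intro n
    induction n with
    | zero => exact hUc
    | succ n ih =>
      rw [hsucc]
      exact (((isCompact_singleton.union ih).union (ih.mul ih)).union ih.inv).union
        (isCompact_compactCovering G n)
  have hmono : Monotone K := monotone_nat_of_le_succ fun n x hx => by
    rw [hsucc]; exact Or.inl (Or.inl (Or.inl (Or.inr hx)))
  have hnhds : ∀ n, K n ∈ 𝓝 (1 : G) := fun n => mem_of_superset hU (hmono n.zero_le)
  refine ⟨K, ⟨fun n => ⟨1, mem_of_mem_nhds (hnhds n)⟩, fun n => (hcpt n).isClosed,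
    fun n => (hcpt n).isBounded, hmono, fun n => mem_of_mem_nhds (hnhds _), fun n x hx => ?_,
    fun n x hx => ?_, eq_univ_of_forall fun x => ?_⟩, fun n => ⟨hcpt n, hnhds n⟩⟩
  · rw [hsucc]; exact Or.inl (Or.inl (Or.inr hx))
  · rw [hsucc]; exact Or.inl (Or.inr hx)
  · obtain ⟨n, hn⟩ := mem_iUnion.1 ((iUnion_compactCovering G).symm ▸ mem_univ x)
    exact mem_iUnion.2 ⟨n + 1, by rw [hsucc]; exact Or.inr hn⟩

theorem UniformContinuous.exists_obeysModulus {X Y : Type*} [MetricSpace X] [MetricSpace Y]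
    {f : X → Y} (hf : UniformContinuous f) : ∃ γ : ContinuityModulus, ObeysModulus γ f := by
  have h : ∀ ε : ℝ, ∃ δ > 0, 0 < ε → ∀ x x', dist x x' < δ → dist (f x) (f x') < ε := by
    intro ε
    by_cases hε : 0 < ε
    · obtain ⟨δ, hδ, h⟩ := Metric.uniformContinuous_iff.1 hf ε hε
      exact ⟨δ, hδ, fun _ x x' hx => h hx⟩
    · exact ⟨1, one_pos, fun h => absurd h hε⟩
  choose δ hδ h using h
  exact ⟨⟨δ, fun ε _ => hδ ε⟩, h⟩

theorem UniformContinuous.exists_obeysModulus₂ {X Y Z : Type*} [MetricSpace X] [MetricSpace Y]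
    [MetricSpace Z] {f : X → Y → Z} (hf : UniformContinuous fun p : X × Y => f p.1 p.2) :
    ∃ γ : ContinuityModulus, ObeysModulus₂ γ f := by
  obtain ⟨γ, hγ⟩ := hf.exists_obeysModulus
  refine ⟨γ, fun y ε hε x x' hx => hγ ε hε (x, y) (x', y) ?_,
    fun x ε hε y y' hy => hγ ε hε (x, y) (x, y') ?_⟩ <;> simpa [Prod.dist_eq, γ.pos ε hε]

theorem exists_groupObeysModuli {G : Type*} [Group G] [MetricSpace G] [IsTopologicalGroup G]
    {K : ℕ → Set G} (hK : ∀ n, IsCompact (K n)) : ∃ F₀ : GroupModuli, GroupObeysModuli K F₀ := by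
  have hmul : ∀ n, ∃ γ : ContinuityModulus,
      ObeysModulus₂ γ fun g h : K n => (g : G) * (h : G) := by
    intro n
    have := isCompact_iff_compactSpace.1 (hK n)
    exact (CompactSpace.uniformContinuous_of_continuous
      (by fun_prop : Continuous fun p : K n × K n => (p.1 : G) * (p.2 : G))).exists_obeysModulus₂
  have hinv : ∀ n, ∃ γ : ContinuityModulus, ObeysModulus γ fun g : K n => (g : G)⁻¹ := by
    intro n
    have := isCompact_iff_compactSpace.1 (hK n)
    exact (CompactSpace.uniformContinuous_of_continuous
      (by fun_prop : Continuous fun g : K n => (g : G)⁻¹)).exists_obeysModulus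
  choose μ hμ using hmul
  choose ι hι using hinv
  exact ⟨⟨μ, ι⟩, fun n => ⟨hμ n, hι n⟩⟩

/-- The midpoint inequality, which makes balls of a real tree uniformly convex. -/
theorem IsRealTree.exists_midpoint {T : Type*} [MetricSpace T] (hT : IsRealTree T) (x y : T) :
    ∃ m : T, ∀ z, dist m z ≤ max (dist x z) (dist y z) - dist x y / 2 := by
  obtain ⟨c, h0, h1, hc⟩ := hT.geodesic x y
  have hd : 0 ≤ dist x y := dist_nonneg
  have hm : dist x y / 2 ∈ Icc 0 (dist x y) := ⟨by linarith, by linarith⟩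
  refine ⟨c (dist x y / 2), fun z => ?_⟩
  have hx := hc 0 ⟨le_rfl, hd⟩ _ hm
  have hy := hc _ hm (dist x y) ⟨hd, le_rfl⟩
  rw [h0, zero_sub, abs_neg, abs_of_nonneg hm.1] at hx
  rw [h1, abs_of_nonpos (by linarith)] at hy
  have h4 := hT.fourPoint (c (dist x y / 2)) z x y
  rw [dist_comm _ x, hx, hy, dist_comm z x, dist_comm z y] at h4
  rcases le_max_iff.1 h4 with h | h
  · linarith [le_max_right (dist x z) (dist y z)]
  · linarith [le_max_left (dist x z) (dist y z)]

/-- A group acting isometrically on a complete real tree with a bounded orbit fixes the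
circumcentre of that orbit. -/
theorem exists_fixedPoint_of_bounded_orbit {G T : Type*} [Group G] [MetricSpace T]
    [CompleteSpace T] [MulAction G T] [IsIsometricSMul G T] (hT : IsRealTree T) (o : T) (R : ℝ)
    (hR : ∀ g : G, dist (g • o) o ≤ R) : ∃ x : T, ∀ g : G, g • x = x := by
  -- `r x` is the radius of the smallest closed ball with centre `x` that contains the orbit.
  let r : T → ℝ := fun x => ⨆ g : G, dist x (g • o)
  have hbdd : ∀ x, BddAbove (range fun g : G => dist x (g • o)) := by
    rintro x
    refine ⟨dist x o + R, ?_⟩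
    rintro _ ⟨g, rfl⟩
    have := dist_triangle x o (g • o)
    rw [dist_comm o] at this
    exact this.trans (by linarith [hR g])
  have hle : ∀ x (g : G), dist x (g • o) ≤ r x := fun x g => le_ciSup (hbdd x) g
  have hr0 : BddBelow (range r) := ⟨0, by
    rintro _ ⟨x, rfl⟩
    exact dist_nonneg.trans (hle x 1)⟩
  have hne : Nonempty T := ⟨o⟩
  let ρ : ℝ := ⨅ x, r x
  have hρ : ∀ x, ρ ≤ r x := fun x => ciInf_le hr0 x
  -- Near-minimizers are close to each other: their midpoint cannot beat the infimum.
  have hclose : ∀ ε x y, r x ≤ ρ + ε → r y ≤ ρ + ε → dist x y ≤ 2 * ε := by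
    intro ε x y hx hy
    obtain ⟨m, hm⟩ := hT.exists_midpoint x y
    have : r m ≤ ρ + ε - dist x y / 2 := ciSup_le fun g =>
      (hm _).trans (sub_le_sub_right (max_le ((hle x g).trans hx) ((hle y g).trans hy)) _)
    linarith [hρ m]
  have hlip : ∀ x y, r x ≤ r y + dist x y := fun x y => ciSup_le fun g => by
    linarith [dist_triangle x y (g • o), hle y g]
  have hex : ∀ n : ℕ, ∃ x, r x < ρ + 1 / ((n : ℝ) + 1) := fun n =>
    exists_lt_of_ciInf_lt (lt_add_of_pos_right ρ Nat.one_div_pos_of_nat)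
  choose x hx using hex
  have hlim : Tendsto (fun n : ℕ => 1 / ((n : ℝ) + 1)) atTop (𝓝 0) :=
    tendsto_one_div_add_atTop_nhds_zero_nat
  have hcau : CauchySeq x := by
    refine cauchySeq_of_le_tendsto_0 (fun n : ℕ => 2 * (1 / ((n : ℝ) + 1))) (fun n m N hn hm => ?_)
      (by simpa using hlim.const_mul 2)
    refine hclose _ _ _ ((hx n).le.trans ?_) ((hx m).le.trans ?_)
    · exact add_le_add_right (Nat.one_div_le_one_div hn) ρ
    · exact add_le_add_right (Nat.one_div_le_one_div hm) ρ
  obtain ⟨c, hc⟩ := cauchySeq_tendsto_of_complete hcau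
  have hcr : r c ≤ ρ := by
    have h1 : Tendsto (fun n : ℕ => ρ + 1 / ((n : ℝ) + 1) + dist c (x n)) atTop (𝓝 ρ) := by
      simpa using (hlim.const_add ρ).add (tendsto_const_nhds.dist hc : Tendsto _ _ (𝓝 (dist c c)))
    exact ge_of_tendsto' h1 fun n => (hlip c (x n)).trans (by linarith [hx n])
  refine ⟨c, fun g => dist_le_zero.1 ?_⟩
  have hgc : r (g • c) ≤ ρ := ciSup_le fun h => by
    have := hle c (g⁻¹ * h)
    rw [← dist_smul g c, smul_smul, mul_inv_cancel_left] at this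
    exact this.trans hcr
  simpa using hclose 0 (g • c) c (by simpa using hgc) (by simpa using hcr)

/-- Without a global fixed point, a single `K l` moves every point of a given ball by at
least `1`. -/
theorem exists_one_le_dist_smul {G T : Type*} [Group G] [MetricSpace T] [CompleteSpace T]
    [MulAction G T] [IsIsometricSMul G T] {K : ℕ → Set G} (hK : ⋃ n, K n = univ)
    (hT : IsRealTree T) (hfix : ¬ ∃ x : T, ∀ g : G, g • x = x) (o : T) (k : ℝ) :
    ∃ l, ∀ x ∈ Metric.closedBall o k, ∃ g ∈ K l, 1 ≤ dist (g • x) x := by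
  by_contra! hcon
  refine hfix (exists_fixedPoint_of_bounded_orbit hT o (2 * k + 1) fun g => ?_)
  obtain ⟨n, hn⟩ := mem_iUnion.1 (hK.symm ▸ mem_univ g)
  obtain ⟨x, hx, h⟩ := hcon n
  have h1 := dist_triangle4 (g • o) (g • x) x o
  rw [dist_smul, dist_comm o x] at h1
  linarith [h g hn, Metric.mem_closedBall.1 hx]

/-- Compact sets of group elements move the base point a bounded distance, and this yields the
function `ν` bounding the action maps. -/
theorem exists_strictMono_smul_mem_closedBall {G T : Type*} [Group G] [MetricSpace G]
    [MetricSpace T] [MulAction G T] [IsIsometricSMul G T] {K : ℕ → Set G}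
    (hK : ∀ n, IsCompact (K n)) (o : T) (ho : Continuous fun g : G => g • o) :
    ∃ ν : ℕ → ℕ → ℕ, (∀ n, StrictMono (ν n)) ∧ (∀ m, StrictMono fun n => ν n m) ∧
      ∀ n m : ℕ, ∀ g ∈ K n, ∀ x ∈ Metric.closedBall o (m : ℝ),
        g • x ∈ Metric.closedBall o (ν n m : ℝ) := by
  have hb : ∀ n, ∃ c : ℕ, ∀ g ∈ K n, dist (g • o) o ≤ c := by
    intro n
    obtain ⟨R, hR⟩ := ((hK n).image ho).isBounded.subset_closedBall o
    obtain ⟨c, hc⟩ := exists_nat_ge R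
    exact ⟨c, fun g hg => (hR ⟨g, hg, rfl⟩ : dist (g • o) o ≤ R).trans hc⟩
  choose c hc using hb
  -- Partial sums make the bounds monotone in `n`, and the summand `n` makes them strictly so.
  refine ⟨fun n m => n + ∑ i ∈ Finset.range (n + 1), c i + m, fun n a b hab => by simpa using hab,
    fun m => strictMono_nat_of_lt_succ fun n => ?_, fun n m g hg x hx => ?_⟩
  · dsimp only
    rw [Finset.sum_range_succ _ (n + 1)]
    lia
  · have h1 := dist_triangle (g • x) (g • o) o
    rw [dist_smul] at h1
    have h2 : c n ≤ ∑ i ∈ Finset.range (n + 1), c i :=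
      Finset.single_le_sum (fun i _ => Nat.zero_le _) (Finset.self_mem_range_succ n)
    have h3 : (c n : ℝ) + m ≤ ((n + ∑ i ∈ Finset.range (n + 1), c i + m : ℕ) : ℝ) := by
      exact_mod_cast (by lia)
    exact Metric.mem_closedBall.2 (by linarith [hc n g hg, Metric.mem_closedBall.1 hx])

theorem actionStructure_mem_classKGR {G : Type u} [Group G] [MetricSpace G]
    [IsTopologicalGroup G] {K : ℕ → Set G} (hK : IsPresentation K) (hKc : ∀ n, IsCompact (K n))
    {F₀ : GroupModuli} (hF₀ : GroupObeysModuli K F₀) {F : ℕ → ℕ → ContinuityModulus}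
    {T : Type v} [MetricSpace T] [CompleteSpace T] [MulAction G T] [IsIsometricSMul G T]
    {o : T} (hT : IsRealTree T) (hF : StronglyModuliContinuous K o F) {ν : ℕ → ℕ → ℕ}
    (hν : ∀ n m : ℕ, ∀ g ∈ K n, ∀ x ∈ Metric.closedBall o (m : ℝ),
      g • x ∈ Metric.closedBall o (ν n m : ℝ)) :
    actionStructure K hK o ν hν ∈ ClassKGR ν F₀ F := by
  refine ⟨fun n => (hKc n).isComplete.completeSpace_coe,
    fun n => Metric.isClosed_closedBall.completeSpace_coe, fun n => (hF₀ n).1, fun n => (hF₀ n).2,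
    fun n m => hF.2 n m, G, inferInstance, inferInstance, inferInstance, T, inferInstance,
    inferInstance, inferInstance, o, fun n => Subtype.val, fun n => Subtype.val, hT, ?_⟩
  exact
    { isometry_i := fun n => isometry_subtype_coe
      isometry_j := fun n => isometry_subtype_coe
      presentation := by
        have h : (fun n => range (Subtype.val : K n → G)) = K := funext fun n => Subtype.range_coe
        exact h.symm ▸ hK
      range_j := fun n => Subtype.range_coe
      map_mul := fun _ _ _ => rfl
      map_inv := fun _ _ => rfl
      map_one := fun _ => rfl
      map_zero := fun _ => rfl
      map_I := fun _ _ _ _ => rfl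
      map_act := fun _ _ _ _ => rfl }

theorem iSup_iInf_max_sub_eq_zero {ι κ : Type*} {a : ℝ} {f : ι → κ → ℝ}
    (h : ∀ i, ∃ j, a ≤ f i j) : ⨆ i, ⨅ j, max (a - f i j) 0 = 0 := by
  have h0 : ∀ i, ⨅ j, max (a - f i j) 0 = 0 := by
    intro i
    obtain ⟨j, hj⟩ := h i
    refine le_antisymm ?_ (Real.iInf_nonneg fun j => le_max_right _ _)
    refine (ciInf_le ⟨0, ?_⟩ j).trans (max_le (sub_nonpos.2 hj) le_rfl)
    rintro _ ⟨j, rfl⟩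
    exact le_max_right _ _
  simp [h0]

theorem mainTheorem9 {G : Type u} [Group G] [MetricSpace G] [IsTopologicalGroup G]
    [LocallyCompactSpace G] [SigmaCompactSpace G] :
    (∃ K : ℕ → Set G, IsPresentation K ∧ ∀ n, IsCompact (K n) ∧ K n ∈ 𝓝 (1 : G)) ∧
    ∀ (K : ℕ → Set G) (hK : IsPresentation K), (∀ n, IsCompact (K n)) →
      (∃ F₀ : GroupModuli, GroupObeysModuli K F₀) ∧
      ∀ (F₀ : GroupModuli), GroupObeysModuli K F₀ →
      ∀ (F : ℕ → ℕ → ContinuityModulus)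
        (T : Type v) [MetricSpace T] [CompleteSpace T] [MulAction G T] [IsIsometricSMul G T]
        (o : T), IsRealTree T → StronglyModuliContinuous K o F →
        (¬ ∃ x : T, ∀ g : G, g • x = x) →
        ∃ (ν : ℕ → ℕ → ℕ) (η : ℕ → ℕ × ℕ)
          (hν : ∀ n m : ℕ, ∀ g ∈ K n, ∀ x ∈ Metric.closedBall o (m : ℝ),
            g • x ∈ Metric.closedBall o (ν n m : ℝ)),
          (∀ n, StrictMono (ν n)) ∧ (∀ m, StrictMono fun n => ν n m) ∧
          actionStructure K hK o ν hν ∈ ClassKnFR ν η F₀ F ∧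
          ∀ k : ℕ, ∀ x ∈ Metric.closedBall o (k : ℝ), ∃ g ∈ K (η k).1,
            (1 : ℝ) / ((η k).2 : ℝ) ≤ dist (g • x) x := by
  refine ⟨exists_isPresentation_isCompact_mem_nhds_one, fun K hK hKc =>
    ⟨exists_groupObeysModuli hKc, ?_⟩⟩
  intro F₀ hF₀ F T _ _ _ _ o hT hF hfix
  obtain ⟨ν, hν₁, hν₂, hν⟩ := exists_strictMono_smul_mem_closedBall hKc o (hF.1 o)
  choose l hl using fun k : ℕ => exists_one_le_dist_smul hK.iUnion_eq hT hfix o (k : ℝ)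
  have hη : ∀ k : ℕ, ∀ x ∈ Metric.closedBall o (k : ℝ), ∃ g ∈ K (l k),
      (1 : ℝ) / ((1 : ℕ) : ℝ) ≤ dist (g • x) x := by simpa using hl
  refine ⟨ν, fun k => (l k, 1), hν, hν₁, hν₂,
    ⟨actionStructure_mem_classKGR hK hKc hF₀ hT hF hν, fun k => ⟨one_pos, ?_⟩⟩, hη⟩
  refine iSup_iInf_max_sub_eq_zero fun v => ?_
  obtain ⟨g, hg, h⟩ := hη k v.1 v.2
  exact ⟨⟨g, hg⟩, h⟩
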